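/- **Setting.** There are $n$ players. Every unordered pair $e$ of distinct players shares a key of $\ell(e)\ge 0$ independent uniformly random bits, known to the two players of $e$ only. In addition each player $m$ draws local private randomness from an arbitrary discrete distribution; all keys and all local random strings are independent. Write $G_m$ for the randomness held by player $m$ (local randomness and the keys shared with the other players). A *protocol* for data items in a set $D$ with $|D|\ge 2$ has a fixed number $k$ of rounds; in each round the players, one after another, transmit one message, which everybody (including any adversary) receives. The message of player $m$ is a function of $m$'s role (sender of a data item $d\in D$, receiver, or neither), of $G_m$, and of the messages transmitted so far. There are no other resources. Let $C$ be the sequence of all $nk$ messages. Any player may be the sender and any other player the receiver. The protocol is *correct* if for all $d\in D$ and all players $s\neq r$, when $s$ is the sender of $d$ and $r$ is the receiver, $r$ computes $d$ from $G_r$ and $C$ in every run of positive probability. The protocol achieves *sender anonymity against all collusions of $t<n-1$ players* if for every set $E$ of $t\le n-2$ players and every $d\in D$ the following holds. Let the sender $S$ of $d$ be uniformly distributed on the $n-t$ players outside $E$, let the receiver be uniformly distributed on the players other than $S$, both independent of all randomness of the players, and let all players follow the protocol. Then for every value $v$ that the view of $E$ (the roles of the players in $E$, $(G_m)_{m\in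 E}$, and $C$) takes with positive probability, $$\max_{\hat S}\ \mathrm{Prob}\big[\hat S = S \,\big|\, \text{view}=v\big]=\frac1{n-t},$$ where the maximum is over all guesses $\hat S$ that depend only on the view. **Corollary.** Every correct protocol of this kind that achieves sender anonymity against all collusions of $t<n-1$ players uses at least $n(n-1)/2$ bits of pairwise shared keys: $$\sum_{e}\ell(e)\ \ge\ \frac{n(n-1)}2 .$$ -/

import Mathlib

open scoped ENNReal

/-! ### Independent random variables -/

theorem tsum_prod_fin_eq {n : ℕ} {R : Fin n → Type*} (p : ∀ m, PMF (R m)) :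
    ∑' g : (∀ m, R m), ∏ m, p m (g m) = 1 := by
  induction n with
  | zero => simp
  | succ n ih =>
    rw [← (Fin.consEquiv R).tsum_eq, ENNReal.tsum_prod']
    simp only [Fin.consEquiv_apply, Fin.prod_univ_succ, Fin.cons_zero, Fin.cons_succ,
      ENNReal.tsum_mul_left]
    simp [ih (fun m => p m.succ), PMF.tsum_coe]

/-- The joint law of independent random variables with laws `p m`. -/
noncomputable def independentPMF {n : ℕ} {R : Fin n → Type*} (p : ∀ m, PMF (R m)) :
    PMF (∀ m, R m) :=
  ⟨fun g => ∏ m, p m (g m), by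
    rw [← tsum_prod_fin_eq p]; exact ENNReal.summable.hasSum⟩

/-! ### Protocols based on pairwise shared keys and public communication -/

/-- An unordered pair of distinct players. -/
abbrev PlayerPair (n : ℕ) : Type := {e : Sym2 (Fin n) // ¬ e.IsDiag}

/-- The role of a player: sender of a data item, receiver, or neither. -/
inductive Role (D : Type*) where
  | sender (d : D)
  | receiver
  | idle

/-- The random string `G_m` held by player `m`: the local private randomness together with the keys
shared with each other player.  It contains neither the role of the player nor the data item. -/
structure PrivateRandomness {n : ℕ} (R : Fin n → Type*) (keyLen : PlayerPair n → ℕ)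
    (m : Fin n) where
  loc : R m
  key : ∀ e : PlayerPair n, m ∈ e.1 → Fin (keyLen e) → Bool

/-- A protocol among `n` players for data items in `D`, with public messages in `M`, whose only
resources are private local randomness, pairwise shared key bits, and public communication that
reaches everybody. -/
structure KeyProtocol (n : ℕ) (D M : Type*) (R : Fin n → Type*) where
  /-- the number of rounds -/
  rounds : ℕ
  /-- the number of key bits shared by each pair of players -/
  keyLen : PlayerPair n → ℕ
  /-- the law of the local randomness of each player -/
  localLaw : ∀ m, PMF (R m)
  /-- the message that a player transmits next, given the role of this player, the randomness
  this player holds, and the list of all the messages transmitted so far -/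
  send : ∀ m, Role D → PrivateRandomness R keyLen m → List M → M
  /-- the data item that a player who is the receiver obtains in the end, given the randomness
  this player holds and the list of all messages -/
  output : ∀ m, PrivateRandomness R keyLen m → List M → D

/-- One run of a protocol: who sends, who receives, the local randomness of the players and
the shared keys. -/
structure Outcome {n : ℕ} (R : Fin n → Type*) (keyLen : PlayerPair n → ℕ) where
  sender : Fin n
  receiver : Fin n
  loc : ∀ m, R m
  keys : ∀ e : PlayerPair n, Fin (keyLen e) → Bool

namespace KeyProtocol

variable {n : ℕ} {D M : Type*} {R : Fin n → Type*}

/-- The total number of bits of pairwise shared keys. -/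
def totalKeyBits (P : KeyProtocol n D M R) : ℕ := ∑ e, P.keyLen e

/-- The role of player `m` when the sender of the run sends the data item `d`. -/
def role (P : KeyProtocol n D M R) (d : D) (ω : Outcome R P.keyLen) (m : Fin n) : Role D :=
  if m = ω.sender then .sender d else if m = ω.receiver then .receiver else .idle

/-- The randomness `G_m` held by player `m` in a run. -/
def held (P : KeyProtocol n D M R) (ω : Outcome R P.keyLen) (m : Fin n) :
    PrivateRandomness R P.keyLen m :=
  ⟨ω.loc m, fun e _ => ω.keys e⟩

/-- One round: the players, one after another, each append one message. -/
def playRound (P : KeyProtocol n D M R) (d : D) (ω : Outcome R P.keyLen) (h : List M) : List M :=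
  (List.finRange n).foldl (fun h m => h ++ [P.send m (P.role d ω m) (P.held ω m) h]) h

/-- The total communication `C` of a run, as the list of all messages in order. -/
def communication (P : KeyProtocol n D M R) (d : D) (ω : Outcome R P.keyLen) : List M :=
  (P.playRound d ω)^[P.rounds] []

/-- The possible pairs (sender, receiver) when the players in `E` are corrupted: the sender is not
corrupted, and the receiver is another player than the sender. -/
def scenarios (E : Finset (Fin n)) : Finset (Fin n × Fin n) :=
  Finset.univ.filter fun c => c.1 ∉ E ∧ c.2 ≠ c.1

theorem scenarios_nonempty (E : Finset (Fin n)) (hE : E.card + 2 ≤ n) :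
    (scenarios E).Nonempty := by
  have h : 1 < (Eᶜ).card := by
    rw [Finset.card_compl, Fintype.card_fin]; omega
  obtain ⟨a, ha, b, hb, hab⟩ := Finset.one_lt_card.mp h
  exact ⟨(a, b), by simp [scenarios, Finset.mem_compl.mp ha, hab.symm]⟩

/-- The law of a run: the sender is uniform among the players outside `E`, the receiver is uniform
among the other players, and independently of that the players draw independent
local randomness and independent uniform key bits. -/
noncomputable def runLaw (P : KeyProtocol n D M R) (E : Finset (Fin n)) (hE : E.card + 2 ≤ n) :
    PMF (Outcome R P.keyLen) :=
  (PMF.uniformOfFinset (scenarios E) (scenarios_nonempty E hE)).bind fun c =>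
    (independentPMF P.localLaw).bind fun g =>
      (PMF.uniformOfFintype (∀ e : PlayerPair n, Fin (P.keyLen e) → Bool)).map fun k =>
        ⟨c.1, c.2, g, k⟩

/-- What a collusion `E` sees: its own roles and randomness, and the total communication. -/
structure View (P : KeyProtocol n D M R) (E : Finset (Fin n)) where
  roles : E → Role D
  held : ∀ m : E, PrivateRandomness R P.keyLen m
  communication : List M

/-- The view of the collusion `E` in a run in which the data item `d` is sent. -/
def view (P : KeyProtocol n D M R) (E : Finset (Fin n)) (d : D) (ω : Outcome R P.keyLen) :
    P.View E :=
  ⟨fun m => P.role d ω m, fun m => P.held ω m, P.communication d ω⟩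

/-- The conditional law of the sender, given that the collusion `E` has the view `v` (which has
positive probability by `hv`). -/
noncomputable def posterior (P : KeyProtocol n D M R) (E : Finset (Fin n)) (hE : E.card + 2 ≤ n)
    (d : D) (v : P.View E)
    (hv : ∃ ω ∈ {ω | P.view E d ω = v}, ω ∈ (P.runLaw E hE).support) : PMF (Fin n) :=
  ((P.runLaw E hE).filter {ω | P.view E d ω = v} hv).map Outcome.sender

/-- Sender anonymity against every collusion of `t ≤ n - 2` players: whatever the data item and
whatever the collusion has seen, the largest conditional probability of naming the sender
correctly, over all guesses that depend only on the view, is the a priori value `1 / (n - t)`. -/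
def SenderAnonymous (P : KeyProtocol n D M R) : Prop :=
  ∀ (E : Finset (Fin n)) (hE : E.card + 2 ≤ n) (d : D) (v : P.View E)
    (hv : ∃ ω ∈ {ω | P.view E d ω = v}, ω ∈ (P.runLaw E hE).support),
    IsGreatest (Set.range fun guess : P.View E → Fin n => P.posterior E hE d v hv (guess v))
      ((n - E.card : ℕ) : ℝ≥0∞)⁻¹

/-- The receiver obtains the data item that is sent, for all data items, senders and receivers
other than the sender, in every run that has positive probability. -/
def Correct (P : KeyProtocol n D M R) : Prop :=
  ∀ (d : D) (ω : Outcome R P.keyLen), ω.receiver ≠ ω.sender →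
    (∀ m, ω.loc m ∈ (P.localLaw m).support) →
    P.output ω.receiver (P.held ω ω.receiver) (P.communication d ω) = d

end KeyProtocol

/-! ### Transcripts and the rectangle property -/

/-! Each pair must share at least one bit; summing over the n(n-1)/2 pairs gives the bound. Suppose
players i and j share none, and let all others collude. The colluders then know every key, so fix
the keys and the colluders' local randomness; only the local randomness of i and j still varies, and
independently.

Let L(r,s) be the transcript law when i has role r and j has role s. Since a message depends only on
its speaker's data and the public history, L(r,s)(C) = p_i(r,C) p_j(s,C) o(C) (`pairLaw_eq_mul`).
With S the sender of d and R the receiver, anonymity gives L(S,R) = L(R,S)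
(`SenderAnonymous.pairLaw_symm`), while the product form gives L(S,S) L(R,R) = L(S,R) L(R,S) =
L(S,R)² pointwise. All these laws have total mass 1, so equality in AM-GM forces L(S,R) = L(R,R)
(`pairLaw_eq_of_symm`), which does not involve d. Hence one transcript is possible for two data
items, and by the product form with the same randomness of j, who would have to output both
(`not_correct_of_symm`). -/

namespace KeyProtocol

variable {n : ℕ} {D M : Type*} {R : Fin n → Type*}

/-- The messages produced when the players in the list speak in turn after the history `h`. -/
def play (P : KeyProtocol n D M R) (ρ : Fin n → Role D)
    (G : ∀ m, PrivateRandomness R P.keyLen m) : List (Fin n) → List M → List M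
  | [], _ => []
  | a :: L, h => P.send a (ρ a) (G a) h :: play P ρ G L (h ++ [P.send a (ρ a) (G a) h])

/-- The messages of player `m` in the continuation `C` of the history `h` are those prescribed by
the protocol. -/
def Consistent (P : KeyProtocol n D M R) (m : Fin n) (r : Role D)
    (g : PrivateRandomness R P.keyLen m) : List (Fin n) → List M → List M → Prop
  | [], _, C => C = []
  | _ :: _, _, [] => False
  | a :: L, h, c :: C => (a = m → P.send m r g h = c) ∧ Consistent P m r g L (h ++ [c]) C

/-- The source of the product form: once C is fixed, the histories are fixed too, so each message
constrains its speaker alone. A player must exist because for an empty schedule the condition C = []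
is only imposed through the players. -/
theorem play_eq_iff (P : KeyProtocol n D M R) (ρ : Fin n → Role D)
    (G : ∀ m, PrivateRandomness R P.keyLen m) (hn : Nonempty (Fin n)) (L : List (Fin n)) :
    ∀ h C, P.play ρ G L h = C ↔ ∀ m, P.Consistent m (ρ m) (G m) L h C := by
  induction L with
  | nil => intro h C; simp [play, Consistent, eq_comm]
  | cons a L ih =>
    intro h C
    cases C with
    | nil => simp [play, Consistent]
    | cons c C =>
      simp only [play, Consistent, List.cons.injEq, forall_and]
      constructor
      · rintro ⟨rfl, h2⟩
        exact ⟨by rintro m rfl; rfl, (ih _ _).1 h2⟩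
      · rintro ⟨h1, h2⟩
        have h1 := h1 a rfl
        subst h1
        exact ⟨rfl, (ih _ _).2 h2⟩

/-- The order in which the players speak. -/
def schedule (P : KeyProtocol n D M R) : List (Fin n) :=
  (List.replicate P.rounds (List.finRange n)).flatten

theorem foldl_eq_append_play (P : KeyProtocol n D M R) (ρ : Fin n → Role D)
    (G : ∀ m, PrivateRandomness R P.keyLen m) (L : List (Fin n)) :
    ∀ h, L.foldl (fun h m => h ++ [P.send m (ρ m) (G m) h]) h = h ++ P.play ρ G L h := by
  induction L with
  | nil => simp [play]
  | cons a L ih => intro h; simp [play, ih]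

theorem communication_eq_play (P : KeyProtocol n D M R) (d : D) (ω : Outcome R P.keyLen) :
    P.communication d ω = P.play (P.role d ω) (P.held ω) P.schedule [] := by
  have key : ∀ k h, (P.playRound d ω)^[k] h =
      (List.replicate k (List.finRange n)).flatten.foldl
        (fun h m => h ++ [P.send m (P.role d ω m) (P.held ω m) h]) h := by
    intro k
    induction k with
    | zero => simp
    | succ k ih =>
      intro h
      rw [Function.iterate_succ_apply, ih, List.replicate_succ, List.flatten_cons,
        List.foldl_append]
      rfl
  rw [communication, key, foldl_eq_append_play]
  rfl

/-! ### Two players whose key is empty -/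

/-- Player `i` has role `r`, player `j` has role `s`, and all others are idle. -/
def pairRoles (i j : Fin n) (r s : Role D) (m : Fin n) : Role D :=
  if m = i then r else if m = j then s else .idle

/-- The local randomness `g` with the entries of players `i` and `j` replaced. -/
def replacePair (i j : Fin n) (g : ∀ m, R m) (x : R i) (y : R j) : ∀ m, R m :=
  Function.update (Function.update g i x) j y

theorem replacePair_left {i j : Fin n} (hij : i ≠ j) (g : ∀ m, R m) (x : R i) (y : R j) :
    replacePair i j g x y i = x := by
  simp [replacePair, hij]

theorem replacePair_right (i j : Fin n) (g : ∀ m, R m) (x : R i) (y : R j) :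
    replacePair i j g x y j = y := by
  simp [replacePair]

theorem replacePair_of_ne {i j m : Fin n} (hi : m ≠ i) (hj : m ≠ j) (g : ∀ m, R m) (x : R i)
    (y : R j) : replacePair i j g x y m = g m := by
  simp [replacePair, hi, hj]

/-- The randomness held by a player with local randomness `x` when the keys are `k`. -/
def heldWith (P : KeyProtocol n D M R) (k : ∀ e : PlayerPair n, Fin (P.keyLen e) → Bool)
    (m : Fin n) (x : R m) : PrivateRandomness R P.keyLen m :=
  ⟨x, fun e _ => k e⟩

open Classical in
/-- The probability that player `m` with role `r` is consistent with the transcript `C`, when the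
keys are `k`. -/
noncomputable def consistencyProb (P : KeyProtocol n D M R)
    (k : ∀ e : PlayerPair n, Fin (P.keyLen e) → Bool) (m : Fin n) (r : Role D) (C : List M) :
    ℝ≥0∞ :=
  ∑' x, P.localLaw m x * if P.Consistent m r (P.heldWith k m x) P.schedule [] C then 1 else 0

open Classical in
/-- Indicator of the event that the idle players other than `i` and `j` are consistent with the
transcript `C`. -/
noncomputable def othersConsistent (P : KeyProtocol n D M R)
    (k : ∀ e : PlayerPair n, Fin (P.keyLen e) → Bool) (g : ∀ m, R m) (i j : Fin n)
    (C : List M) : ℝ≥0∞ :=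
  if ∀ m, m ≠ i → m ≠ j → P.Consistent m .idle (P.heldWith k m (g m)) P.schedule [] C
    then 1 else 0

/-- The transcript when `i` and `j` have roles `r`, `s` and local randomness `x`, `y`. -/
def pairPlay (P : KeyProtocol n D M R)
    (k : ∀ e : PlayerPair n, Fin (P.keyLen e) → Bool) (g : ∀ m, R m) (i j : Fin n)
    (r s : Role D) (x : R i) (y : R j) : List M :=
  P.play (pairRoles i j r s) (fun m => P.heldWith k m (replacePair i j g x y m)) P.schedule []

theorem pairPlay_eq_iff (P : KeyProtocol n D M R)
    (k : ∀ e : PlayerPair n, Fin (P.keyLen e) → Bool) (g : ∀ m, R m) {i j : Fin n}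
    (hij : i ≠ j) (r s : Role D) (x : R i) (y : R j) (C : List M) :
    P.pairPlay k g i j r s x y = C ↔
      P.Consistent i r (P.heldWith k i x) P.schedule [] C ∧
      P.Consistent j s (P.heldWith k j y) P.schedule [] C ∧
      ∀ m, m ≠ i → m ≠ j → P.Consistent m .idle (P.heldWith k m (g m)) P.schedule [] C := by
  rw [pairPlay, play_eq_iff P _ _ ⟨i⟩]
  constructor
  · intro h
    refine ⟨?_, ?_, fun m hi hj => ?_⟩
    · simpa [pairRoles, replacePair_left hij] using h i
    · simpa [pairRoles, replacePair_right, hij.symm] using h j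
    · simpa [pairRoles, replacePair_of_ne hi hj, hi, hj] using h m
  · rintro ⟨h1, h2, h3⟩ m
    by_cases hi : m = i
    · subst hi; simpa [pairRoles, replacePair_left hij] using h1
    by_cases hj : m = j
    · subst hj; simpa [pairRoles, replacePair_right, hij.symm] using h2
    simpa [pairRoles, replacePair_of_ne hi hj, hi, hj] using h3 m hi hj

open Classical in
/-- The probability of the transcript `C` when `i` and `j` have roles `r` and `s` and draw their
local randomness, while the keys and the randomness of the other players are fixed. -/
noncomputable def pairLaw (P : KeyProtocol n D M R)
    (k : ∀ e : PlayerPair n, Fin (P.keyLen e) → Bool) (g : ∀ m, R m) (i j : Fin n)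
    (r s : Role D) (C : List M) : ℝ≥0∞ :=
  ∑' x, ∑' y, P.localLaw i x * P.localLaw j y *
    if P.pairPlay k g i j r s x y = C then 1 else 0

/-- The event "transcript = C" is a rectangle in (x, y), and x, y are independent. -/
theorem pairLaw_eq_mul (P : KeyProtocol n D M R)
    (k : ∀ e : PlayerPair n, Fin (P.keyLen e) → Bool) (g : ∀ m, R m) {i j : Fin n}
    (hij : i ≠ j) (r s : Role D) (C : List M) :
    P.pairLaw k g i j r s C =
      P.consistencyProb k i r C * P.consistencyProb k j s C * P.othersConsistent k g i j C := by
  classical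
  rw [pairLaw, consistencyProb, consistencyProb, ← ENNReal.tsum_mul_right,
    ← ENNReal.tsum_mul_right]
  refine tsum_congr fun x => ?_
  rw [← ENNReal.tsum_mul_left, ← ENNReal.tsum_mul_right]
  refine tsum_congr fun y => ?_
  simp only [pairPlay_eq_iff P k g hij, othersConsistent]
  split_ifs <;> first | (simp; done) | (exfalso; tauto)

theorem tsum_pairLaw (P : KeyProtocol n D M R)
    (k : ∀ e : PlayerPair n, Fin (P.keyLen e) → Bool) (g : ∀ m, R m) (i j : Fin n)
    (r s : Role D) : ∑' C, P.pairLaw k g i j r s C = 1 := by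
  classical
  simp only [pairLaw]
  rw [ENNReal.tsum_comm]
  have (x : R i) : ∑' C, ∑' y, P.localLaw i x * P.localLaw j y *
      (if P.pairPlay k g i j r s x y = C then 1 else 0) = P.localLaw i x := by
    rw [ENNReal.tsum_comm]
    simp [ENNReal.tsum_mul_left, PMF.tsum_coe]
  simp only [this, PMF.tsum_coe]

/-- Equality case of AM-GM: 2X ≤ A + B pointwise, but both sides sum to 2, so equality holds
everywhere, which forces A = B = X. -/
theorem _root_.eq_of_mul_eq_sq_of_tsum_eq_one {T : Type*} {A B X : T → ℝ≥0∞}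
    (hA : ∑' t, A t = 1) (hB : ∑' t, B t = 1) (hX : ∑' t, X t = 1)
    (h : ∀ t, A t * B t = X t * X t) (t : T) : X t = B t := by
  have fin {F : T → ℝ≥0∞} (hF : ∑' t, F t = 1) (t : T) : F t ≠ ⊤ :=
    ENNReal.ne_top_of_tsum_ne_top (by rw [hF]; exact ENNReal.one_ne_top) t
  have hreal (t : T) : (A t).toReal * (B t).toReal = (X t).toReal * (X t).toReal := by
    rw [← ENNReal.toReal_mul, h t, ENNReal.toReal_mul]
  have hle (t : T) : X t + X t ≤ A t + B t := by
    rw [← ENNReal.toReal_le_toReal (by simp [fin hX t]) (by simp [fin hA t, fin hB t]),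
      ENNReal.toReal_add (fin hX t) (fin hX t), ENNReal.toReal_add (fin hA t) (fin hB t)]
    have hr := hreal t
    have := @ENNReal.toReal_nonneg (A t)
    have := @ENNReal.toReal_nonneg (B t)
    refine le_of_sq_le_sq ?_ (by positivity)
    nlinarith [sq_nonneg ((A t).toReal - (B t).toReal)]
  have heq : X t + X t = A t + B t := by
    by_contra hne
    have hlt := ENNReal.tsum_lt_tsum (f := fun t => X t + X t) (g := fun t => A t + B t) (i := t)
      (by rw [ENNReal.tsum_add, hX]; simp) hle (lt_of_le_of_ne (hle t) hne)
    rw [ENNReal.tsum_add, ENNReal.tsum_add, hX, hA, hB] at hlt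
    exact lt_irrefl _ hlt
  have heq' : (X t).toReal + (X t).toReal = (A t).toReal + (B t).toReal := by
    rw [← ENNReal.toReal_add (fin hX t) (fin hX t), heq, ENNReal.toReal_add (fin hA t) (fin hB t)]
  rw [← ENNReal.toReal_eq_toReal_iff' (fin hX t) (fin hB t)]
  have hr := hreal t
  have : ((A t).toReal - (B t).toReal) ^ 2 = 0 := by
    have h2 : ((A t).toReal + (B t).toReal) ^ 2 = 4 * ((X t).toReal * (X t).toReal) := by
      rw [← heq']; ring
    linear_combination h2 - 4 * hr
  have := pow_eq_zero_iff (two_ne_zero) |>.1 this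
  linarith

/-- If the transcript law does not change when sender and idle receiver are exchanged, then it is
the law of the transcript of two receivers. -/
theorem pairLaw_eq_of_symm (P : KeyProtocol n D M R)
    (k : ∀ e : PlayerPair n, Fin (P.keyLen e) → Bool) (g : ∀ m, R m) {i j : Fin n}
    (hij : i ≠ j) {r s : Role D}
    (h : ∀ C, P.pairLaw k g i j r s C = P.pairLaw k g i j s r C) (C : List M) :
    P.pairLaw k g i j r s C = P.pairLaw k g i j s s C := by
  refine eq_of_mul_eq_sq_of_tsum_eq_one (P.tsum_pairLaw k g i j r r) (P.tsum_pairLaw k g i j s s)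
    (P.tsum_pairLaw k g i j r s) (fun C => ?_) C
  -- The square becomes L(r,s) L(s,r), which has the same factors as L(r,r) L(s,s).
  nth_rewrite 2 [h C]
  simp only [pairLaw_eq_mul P k g hij]
  ring

theorem exists_of_pairLaw_ne_zero (P : KeyProtocol n D M R)
    (k : ∀ e : PlayerPair n, Fin (P.keyLen e) → Bool) (g : ∀ m, R m) {i j : Fin n}
    {r s : Role D} {C : List M} (h : P.pairLaw k g i j r s C ≠ 0) :
    ∃ x ∈ (P.localLaw i).support, ∃ y ∈ (P.localLaw j).support,
      P.pairPlay k g i j r s x y = C := by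
  classical
  by_contra! hc
  refine h ?_
  simp only [pairLaw, ENNReal.tsum_eq_zero]
  intro x y
  by_cases hx : P.localLaw i x = 0
  · simp [hx]
  by_cases hy : P.localLaw j y = 0
  · simp [hy]
  simp [hc x hx y hy]

/-! ### Exchange symmetry contradicts correctness -/

theorem communication_pair_left (P : KeyProtocol n D M R)
    (k : ∀ e : PlayerPair n, Fin (P.keyLen e) → Bool) (g : ∀ m, R m) (i j : Fin n)
    (d : D) (x : R i) (y : R j) :
    P.communication d ⟨i, j, replacePair i j g x y, k⟩ =
      P.pairPlay k g i j (.sender d) .receiver x y :=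
  communication_eq_play ..

theorem communication_pair_right (P : KeyProtocol n D M R)
    (k : ∀ e : PlayerPair n, Fin (P.keyLen e) → Bool) (g : ∀ m, R m) {i j : Fin n} (hij : i ≠ j)
    (d : D) (x : R i) (y : R j) :
    P.communication d ⟨j, i, replacePair i j g x y, k⟩ =
      P.pairPlay k g i j .receiver (.sender d) x y := by
  rw [communication_eq_play, pairPlay]
  congr 1
  funext m
  simp only [role, pairRoles]
  split_ifs with h1 h2 <;> first | rfl | (exact absurd (h2.symm.trans h1) hij)

/-- If the transcript law does not reveal which of two players is the sender although all the
other randomness is fixed, then the receiver cannot learn the data item. -/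
theorem not_correct_of_symm [Nontrivial D] (P : KeyProtocol n D M R)
    (k : ∀ e : PlayerPair n, Fin (P.keyLen e) → Bool) (g : ∀ m, R m)
    (hg : ∀ m, g m ∈ (P.localLaw m).support) {i j : Fin n} (hij : i ≠ j)
    (h : ∀ d C, P.pairLaw k g i j (.sender d) .receiver C =
      P.pairLaw k g i j .receiver (.sender d) C) : ¬ P.Correct := by
  intro hcorrect
  obtain ⟨d, d', hd⟩ := exists_pair_ne D
  obtain ⟨C, hC⟩ : ∃ C, P.pairLaw k g i j (.sender d) .receiver C ≠ 0 := by
    by_contra! hc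
    simpa [hc] using P.tsum_pairLaw k g i j (.sender d) .receiver
  have hC' : P.pairLaw k g i j (.sender d') .receiver C ≠ 0 := by
    -- Passage through the law for two receivers, which mentions neither d nor d'.
    rwa [pairLaw_eq_of_symm P k g hij (h d'), ← pairLaw_eq_of_symm P k g hij (h d)]
  obtain ⟨x, hx, y, hy, hxy⟩ := exists_of_pairLaw_ne_zero P k g hC
  obtain ⟨x', hx', y', -, hxy'⟩ := exists_of_pairLaw_ne_zero P k g hC'
  -- Hybrid run: the sender's randomness comes from the run for d', the receiver's from the run for
  -- d.
  have hxy'' : P.pairPlay k g i j (.sender d') .receiver x' y = C := by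
    rw [pairPlay_eq_iff P k g hij] at hxy hxy' ⊢
    exact ⟨hxy'.1, hxy.2.1, hxy.2.2⟩
  have run (d : D) (x : R i) (hx : x ∈ (P.localLaw i).support)
      (hC : P.pairPlay k g i j (.sender d) .receiver x y = C) :
      P.output j (P.heldWith k j y) C = d := by
    have := hcorrect d ⟨i, j, replacePair i j g x y, k⟩ hij.symm fun m => by
      by_cases hi : m = i
      · subst hi; simpa only [replacePair_left hij] using hx
      by_cases hj : m = j
      · subst hj; simpa only [replacePair_right] using hy
      simpa only [replacePair_of_ne hi hj] using hg m
    rw [communication_pair_left, hC] at this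
    rw [← this]
    simp [held, heldWith, replacePair_right]
  exact hd ((run d x hx hxy).symm.trans (run d' x' hx' hxy''))

/-! ### The posterior law of the sender -/

open Classical in
theorem tsum_agreeing_off_pair (p : ∀ m, PMF (R m)) (g : ∀ m, R m) {i j : Fin n} (hij : i ≠ j)
    (F : (∀ m, R m) → ℝ≥0∞) :
    ∑' f, independentPMF p f * (if ∀ m, m ≠ i → m ≠ j → f m = g m then F f else 0) =
      (∏ m ∈ (Finset.univ.erase i).erase j, p m (g m)) *
        ∑' x, ∑' y, p i x * p j y * F (replacePair i j g x y) := by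
  have inj : Function.Injective fun z : R i × R j => replacePair i j g z.1 z.2 := by
    rintro ⟨x, y⟩ ⟨x', y'⟩ h
    have h1 := congrFun h i
    have h2 := congrFun h j
    simp only [replacePair_left hij, replacePair_right] at h1 h2
    rw [h1, h2]
  rw [← inj.tsum_eq, ENNReal.tsum_prod', ← ENNReal.tsum_mul_left]
  · refine tsum_congr fun x => ?_
    rw [← ENNReal.tsum_mul_left]
    refine tsum_congr fun y => ?_
    rw [if_pos fun m hi hj => replacePair_of_ne hi hj g x y]
    have : independentPMF p (replacePair i j g x y) =
        p i x * (p j y * ∏ m ∈ (Finset.univ.erase i).erase j, p m (g m)) := by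
      change ∏ m, p m (replacePair i j g x y m) = _
      rw [← Finset.mul_prod_erase _ _ (Finset.mem_univ i),
        ← Finset.mul_prod_erase (Finset.univ.erase i) _ (Finset.mem_erase.2 ⟨hij.symm, Finset.mem_univ j⟩),
        replacePair_left hij, replacePair_right]
      congr 2
      refine Finset.prod_congr rfl fun m hm => ?_
      simp only [Finset.mem_erase] at hm
      rw [replacePair_of_ne hm.2.1 hm.1]
    rw [this]
    ring
  · intro f hf
    rw [Function.mem_support] at hf
    have hf' : ∀ m, m ≠ i → m ≠ j → f m = g m := by
      by_contra hc
      simp [hc] at hf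
    refine ⟨(f i, f j), funext fun m => ?_⟩
    by_cases hi : m = i
    · subst hi; simp only [replacePair_left hij]
    by_cases hj : m = j
    · subst hj; simp only [replacePair_right]
    simp only [replacePair_of_ne hi hj, hf' m hi hj]

theorem tsum_bind_mul {α β : Type*} (p : PMF α) (f : α → PMF β) (F : β → ℝ≥0∞) :
    ∑' b, p.bind f b * F b = ∑' a, p a * ∑' b, f a b * F b := by
  simp only [PMF.bind_apply, ← ENNReal.tsum_mul_right, ← ENNReal.tsum_mul_left]
  rw [ENNReal.tsum_comm]
  simp only [mul_assoc]

theorem tsum_map_mul {α β : Type*} (p : PMF α) (f : α → β) (F : β → ℝ≥0∞) :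
    ∑' b, p.map f b * F b = ∑' a, p a * F (f a) := by
  classical
  rw [PMF.map, tsum_bind_mul]
  refine tsum_congr fun a => ?_
  congr 1
  rw [tsum_eq_single (f a)]
  · simp
  · intro b hb
    simp [hb]

theorem tsum_runLaw_mul (P : KeyProtocol n D M R) (E : Finset (Fin n)) (hE : E.card + 2 ≤ n)
    (F : Outcome R P.keyLen → ℝ≥0∞) :
    ∑' ω, P.runLaw E hE ω * F ω =
      ∑' c, PMF.uniformOfFinset (scenarios E) (scenarios_nonempty E hE) c *
        ∑' f, independentPMF P.localLaw f *
          ∑' k, PMF.uniformOfFintype (∀ e : PlayerPair n, Fin (P.keyLen e) → Bool) k *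
            F ⟨c.1, c.2, f, k⟩ := by
  simp only [runLaw, tsum_bind_mul, tsum_map_mul]

-- The normalizing factor does not depend on `a`, so comparing posteriors amounts to comparing joint
-- probabilities.
open Classical in
theorem posterior_apply (P : KeyProtocol n D M R) (E : Finset (Fin n)) (hE : E.card + 2 ≤ n)
    (d : D) (v : P.View E)
    (hv : ∃ ω ∈ {ω | P.view E d ω = v}, ω ∈ (P.runLaw E hE).support) (a : Fin n) :
    P.posterior E hE d v hv a =
      (∑' ω, P.runLaw E hE ω * if ω.sender = a ∧ P.view E d ω = v then 1 else 0) *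
        (∑' ω, Set.indicator {ω | P.view E d ω = v} (P.runLaw E hE) ω)⁻¹ := by
  rw [posterior, PMF.map_apply, ← ENNReal.tsum_mul_right]
  refine tsum_congr fun ω => ?_
  rw [PMF.filter_apply]
  simp only [eq_comm (a := a) (b := ω.sender), Set.indicator, Set.mem_ofPred_eq]
  by_cases h1 : ω.sender = a <;> by_cases h2 : P.view E d ω = v <;> simp [h1, h2]

/-- The view in which all colluders are idle. -/
def idleView (P : KeyProtocol n D M R) (k : ∀ e : PlayerPair n, Fin (P.keyLen e) → Bool)
    (g : ∀ m, R m) (E : Finset (Fin n)) (C : List M) : P.View E :=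
  ⟨fun _ => .idle, fun m => P.heldWith k m (g m), C⟩

/-- Every pair other than {a, b} contains a colluder and the key of {a, b} is empty, so the view
determines all keys. Idle colluders leave b as the only possible receiver. -/
theorem view_eq_idleView_iff (P : KeyProtocol n D M R)
    (k : ∀ e : PlayerPair n, Fin (P.keyLen e) → Bool) (g : ∀ m, R m) {a b : Fin n} (hab : a ≠ b)
    (hlen : ∀ e : PlayerPair n, e.1 = s(a, b) → P.keyLen e = 0)
    {E : Finset (Fin n)} (hE : ∀ m, m ∈ E ↔ m ≠ a ∧ m ≠ b) (d : D) (C : List M)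
    (c : Fin n) (hca : c ≠ a) (f : ∀ m, R m)
    (k' : ∀ e : PlayerPair n, Fin (P.keyLen e) → Bool) :
    P.view E d ⟨a, c, f, k'⟩ = P.idleView k g E C ↔
      c = b ∧ k' = k ∧ (∀ m, m ≠ a → m ≠ b → f m = g m) ∧
        P.communication d ⟨a, b, f, k⟩ = C := by
  constructor
  · intro h
    simp only [view, idleView, View.mk.injEq] at h
    obtain ⟨h1, h2, h3⟩ := h
    have hc : c = b := by
      by_contra hcb
      have := congrFun h1 ⟨c, (hE c).2 ⟨hca, hcb⟩⟩
      simp [role, hca] at this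
    have hk : k' = k := by
      funext e
      by_cases he : e.1 = s(a, b)
      · funext q
        have := hlen e he
        exact absurd q.2 (by omega)
      · obtain ⟨m, hm, hma, hmb⟩ : ∃ m ∈ e.1, m ≠ a ∧ m ≠ b := by
          obtain ⟨z, hz⟩ := e
          induction z with
          | _ x y =>
            simp only [Sym2.mk_isDiag_iff] at hz
            simp only [Sym2.eq_iff] at he
            simp only [Sym2.mem_iff]
            by_contra! hc
            have hx := hc x (Or.inl rfl)
            have hy := hc y (Or.inr rfl)
            grind
        have := congrFun h2 ⟨m, (hE m).2 ⟨hma, hmb⟩⟩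
        simp only [held, heldWith, PrivateRandomness.mk.injEq] at this
        exact congrFun (congrFun this.2 e) hm
    subst hc hk
    refine ⟨rfl, rfl, fun m hma hmb => ?_, h3⟩
    have := congrFun h2 ⟨m, (hE m).2 ⟨hma, hmb⟩⟩
    simp only [held, heldWith, PrivateRandomness.mk.injEq] at this
    exact this.1
  · rintro ⟨rfl, rfl, h1, h2⟩
    simp only [view, idleView, View.mk.injEq]
    refine ⟨funext fun m => ?_, funext fun m => ?_, h2⟩
    · have := (hE m).1 m.2
      simp [role, this.1, this.2]
    · have := (hE m).1 m.2
      simp [held, heldWith, h1 m this.1 this.2]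

open Classical in
theorem tsum_runLaw_idleView (P : KeyProtocol n D M R)
    (k : ∀ e : PlayerPair n, Fin (P.keyLen e) → Bool) (g : ∀ m, R m) {a b : Fin n} (hab : a ≠ b)
    (hlen : ∀ e : PlayerPair n, e.1 = s(a, b) → P.keyLen e = 0)
    {E : Finset (Fin n)} (hcard : E.card + 2 ≤ n) (hE : ∀ m, m ∈ E ↔ m ≠ a ∧ m ≠ b)
    (d : D) (C : List M) :
    ∑' ω, P.runLaw E hcard ω *
        (if ω.sender = a ∧ P.view E d ω = P.idleView k g E C then 1 else 0) =
      ((scenarios E).card : ℝ≥0∞)⁻¹ *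
        (PMF.uniformOfFintype (∀ e : PlayerPair n, Fin (P.keyLen e) → Bool) k *
          ∑' f, independentPMF P.localLaw f * (if ∀ m, m ≠ a → m ≠ b → f m = g m then
            if P.communication d ⟨a, b, f, k⟩ = C then 1 else 0 else 0)) := by
  have hmem : (a, b) ∈ scenarios E := by simp [scenarios, hE, hab.symm]
  rw [tsum_runLaw_mul, tsum_eq_single (a, b), PMF.uniformOfFinset_apply_of_mem _ hmem]
  · congr 1
    rw [← ENNReal.tsum_mul_left]
    refine tsum_congr fun f => ?_
    rw [tsum_eq_single k]
    · simp only [view_eq_idleView_iff P k g hab hlen hE d C b hab.symm, true_and,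
        ite_and]
      exact mul_left_comm _ _ _
    · intro k' hk'
      simp [view_eq_idleView_iff P k g hab hlen hE d C b hab.symm, hk']
  · rintro ⟨s, c⟩ hsc
    by_cases hmem' : (s, c) ∈ scenarios E
    · have hcs : c ≠ s := by simp [scenarios] at hmem'; exact hmem'.2
      refine mul_eq_zero_of_right _ (ENNReal.tsum_eq_zero.2 fun f =>
        mul_eq_zero_of_right _ (ENNReal.tsum_eq_zero.2 fun k' => mul_eq_zero_of_right _
          (if_neg ?_)))
      rintro ⟨hs, hview⟩
      obtain rfl : s = a := hs
      rw [view_eq_idleView_iff P k g hab hlen hE d C c hcs] at hview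
      exact hsc (by rw [hview.1])
    · rw [PMF.uniformOfFinset_apply_of_notMem _ hmem', zero_mul]

/-! ### From anonymity to exchange symmetry -/

theorem sender_notMem_of_mem_support_runLaw (P : KeyProtocol n D M R) {E : Finset (Fin n)}
    {hE : E.card + 2 ≤ n} {ω : Outcome R P.keyLen} (h : ω ∈ (P.runLaw E hE).support) :
    ω.sender ∉ E := by
  simp only [runLaw, PMF.mem_support_bind_iff, PMF.mem_support_map_iff,
    PMF.mem_support_uniformOfFinset_iff] at h
  obtain ⟨c, hc, f, -, k, -, rfl⟩ := h
  simp only [scenarios, Finset.mem_filter] at hc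
  exact hc.2.1

/-- Against all players but two, sender anonymity makes the two candidates equally likely. -/
theorem SenderAnonymous.posterior_eq {P : KeyProtocol n D M R} (hanon : P.SenderAnonymous)
    {a b : Fin n} (hab : a ≠ b) {E : Finset (Fin n)} (hcard : E.card + 2 ≤ n)
    (hE : ∀ m, m ∈ E ↔ m ≠ a ∧ m ≠ b) (d : D) (v : P.View E)
    (hv : ∃ ω ∈ {ω | P.view E d ω = v}, ω ∈ (P.runLaw E hcard).support) :
    P.posterior E hcard d v hv a = P.posterior E hcard d v hv b := by
  have hn : n - E.card = 2 := by
    have h1 : Eᶜ = {a, b} := by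
      ext m
      simp only [Finset.mem_compl, hE, Finset.mem_insert, Finset.mem_singleton]
      tauto
    have h2 := Finset.card_compl E
    rw [h1, Finset.card_pair hab, Fintype.card_fin] at h2
    exact h2.symm
  have hle (m : Fin n) : P.posterior E hcard d v hv m ≤ 2⁻¹ := by
    have := (hanon E hcard d v hv).2 ⟨fun _ => m, rfl⟩
    simpa [hn] using this
  have hzero (m : Fin n) (hma : m ≠ a) (hmb : m ≠ b) : P.posterior E hcard d v hv m = 0 := by
    rw [PMF.apply_eq_zero_iff]
    intro hm
    simp only [posterior, PMF.mem_support_map_iff, PMF.mem_support_filter_iff] at hm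
    obtain ⟨ω, hω, rfl⟩ := hm
    exact sender_notMem_of_mem_support_runLaw P hω.2 ((hE _).2 ⟨hma, hmb⟩)
  -- The posterior lives on {a, b}; two numbers at most 1/2 with sum 1 are both 1/2.
  have hsum : P.posterior E hcard d v hv a + P.posterior E hcard d v hv b = 1 := by
    rw [← PMF.tsum_coe (P.posterior E hcard d v hv),
      tsum_eq_sum (s := {a, b}) (fun m hm => by simp at hm; exact hzero m hm.1 hm.2),
      Finset.sum_pair hab]
  have half {x y : ℝ≥0∞} (hx : x ≤ 2⁻¹) (hy : y ≤ 2⁻¹) (hxy : x + y = 1) : x = 2⁻¹ := by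
    refine le_antisymm hx ?_
    by_contra! hlt
    have := ENNReal.add_lt_add_of_lt_of_le (by simpa using ne_top_of_le_ne_top (by simp) hy) hlt hy
    rw [hxy, ENNReal.inv_two_add_inv_two] at this
    exact lt_irrefl _ this
  rw [half (hle a) (hle b) hsum, half (hle b) (hle a) (by rw [add_comm]; exact hsum)]

/-- Up to a common weight `W`, nonzero and finite, both transcript laws are joint probabilities of
the sender and one idle view, and anonymity makes these equal. -/
theorem SenderAnonymous.pairLaw_symm {P : KeyProtocol n D M R} (hanon : P.SenderAnonymous)
    (k : ∀ e : PlayerPair n, Fin (P.keyLen e) → Bool) (g : ∀ m, R m)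
    (hg : ∀ m, g m ∈ (P.localLaw m).support) {i j : Fin n} (hij : i ≠ j)
    (hlen : ∀ e : PlayerPair n, e.1 = s(i, j) → P.keyLen e = 0) (d : D) (C : List M) :
    P.pairLaw k g i j (.sender d) .receiver C = P.pairLaw k g i j .receiver (.sender d) C := by
  classical
  set E : Finset (Fin n) := {i, j}ᶜ with hEdef
  have hE (m : Fin n) : m ∈ E ↔ m ≠ i ∧ m ≠ j := by simp [hEdef]
  have hE' (m : Fin n) : m ∈ E ↔ m ≠ j ∧ m ≠ i := by rw [hE, and_comm]
  have hcard : E.card + 2 ≤ n := by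
    have h1 := Finset.card_add_card_compl ({i, j} : Finset (Fin n))
    rw [Finset.card_pair hij, Fintype.card_fin, ← hEdef] at h1
    omega
  have hlen' : ∀ e : PlayerPair n, e.1 = s(j, i) → P.keyLen e = 0 := fun e he =>
    hlen e (he.trans Sym2.eq_swap)
  set W : ℝ≥0∞ := ((scenarios E).card : ℝ≥0∞)⁻¹ *
    (PMF.uniformOfFintype (∀ e : PlayerPair n, Fin (P.keyLen e) → Bool) k *
      ∏ m ∈ (Finset.univ.erase i).erase j, P.localLaw m (g m)) with hW
  have hW0 : W ≠ 0 := by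
    refine mul_ne_zero (by simp) (mul_ne_zero ?_ (Finset.prod_ne_zero_iff.2 fun m _ => hg m))
    exact (PMF.mem_support_iff _ _).1 (PMF.mem_support_uniformOfFintype k)
  have hWtop : W ≠ ⊤ := by
    refine ENNReal.mul_ne_top ?_ (ENNReal.mul_ne_top (PMF.apply_ne_top _ _)
      (ENNReal.prod_ne_top fun m _ => PMF.apply_ne_top _ _))
    simpa [Finset.nonempty_iff_ne_empty] using scenarios_nonempty E hcard
  have left : ∑' ω, P.runLaw E hcard ω *
      (if ω.sender = i ∧ P.view E d ω = P.idleView k g E C then 1 else 0) =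
      W * P.pairLaw k g i j (.sender d) .receiver C := by
    rw [tsum_runLaw_idleView P k g hij hlen hcard hE, tsum_agreeing_off_pair _ _ hij, pairLaw]
    simp only [communication_pair_left, hW, mul_assoc]
  have right : ∑' ω, P.runLaw E hcard ω *
      (if ω.sender = j ∧ P.view E d ω = P.idleView k g E C then 1 else 0) =
      W * P.pairLaw k g i j .receiver (.sender d) C := by
    rw [tsum_runLaw_idleView P k g hij.symm hlen' hcard hE']
    -- Restores the order i, j, so that the same weight `W` comes out.
    simp only [forall_comm (α := _ ≠ j)]
    rw [tsum_agreeing_off_pair _ _ hij, pairLaw]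
    simp only [communication_pair_right P k g hij, hW, mul_assoc]
  rw [← ENNReal.mul_right_inj hW0 hWtop, ← left, ← right]
  by_cases hv : ∃ ω ∈ {ω | P.view E d ω = P.idleView k g E C}, ω ∈ (P.runLaw E hcard).support
  · have := hanon.posterior_eq hij hcard hE d _ hv
    rw [posterior_apply, posterior_apply] at this
    refine (ENNReal.mul_left_inj ?_ ?_).1 this
    · refine ENNReal.inv_ne_zero.2 (ne_top_of_le_ne_top ENNReal.one_ne_top ?_)
      rw [← PMF.tsum_coe (P.runLaw E hcard)]
      exact ENNReal.tsum_le_tsum fun ω => Set.indicator_le_self _ _ _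
    · refine ENNReal.inv_ne_top.2 fun h0 => ?_
      obtain ⟨ω, hω, hωs⟩ := hv
      have := ENNReal.tsum_eq_zero.1 h0 ω
      rw [Set.indicator_of_mem hω] at this
      exact hωs this
  -- For a view of probability zero there is no posterior, but both joint probabilities vanish.
  · have hz (ω : Outcome R P.keyLen) (hω : P.view E d ω = P.idleView k g E C) :
        P.runLaw E hcard ω = 0 := by
      rw [PMF.apply_eq_zero_iff]
      exact fun hs => hv ⟨ω, hω, hs⟩
    refine tsum_congr fun ω => ?_
    by_cases hω : P.view E d ω = P.idleView k g E C
    · simp [hz ω hω]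
    · simp [hω]

/-- Every pair of players shares at least one key bit. -/
theorem one_le_keyLen [Nontrivial D] (P : KeyProtocol n D M R) (hcorrect : P.Correct)
    (hanon : P.SenderAnonymous) (e : PlayerPair n) : 1 ≤ P.keyLen e := by
  by_contra! hlt
  obtain ⟨z, hz⟩ := e
  induction z with
  | _ i j =>
    have hij : i ≠ j := by simpa using hz
    -- Any local randomness of positive probability and any keys will do.
    choose g hg using fun m => (P.localLaw m).support_nonempty
    refine not_correct_of_symm P (fun _ _ => false) g hg hij (fun d C =>
      hanon.pairLaw_symm _ g hg hij (fun e he => ?_) d C) hcorrect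
    obtain ⟨w, hw⟩ := e
    obtain rfl : w = s(i, j) := he
    omega

end KeyProtocol

theorem mainTheorem5 (n : ℕ) {D M : Type*} [Nontrivial D] {R : Fin n → Type*}
    (P : KeyProtocol n D M R) (hcorrect : P.Correct) (hanon : P.SenderAnonymous) :
    n * (n - 1) / 2 ≤ P.totalKeyBits := by
  calc n * (n - 1) / 2 = ∑ _e : PlayerPair n, 1 := by
        rw [Finset.sum_const, smul_eq_mul, mul_one, Finset.card_univ,
          Sym2.card_subtype_not_diag, Fintype.card_fin, Nat.choose_two_right]
    _ ≤ P.totalKeyBits := Finset.sum_le_sum fun e _ => P.one_le_keyLen hcorrect hanon e
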